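/- Let $\mathbb X,\mathbb Y$ be Euclidean Jordan algebras, i.e. finite-dimensional real inner product spaces with a commutative bilinear product $\circ$ satisfying $x\circ(x^2\circ y)=x^2\circ(x\circ y)$ (where $x^2=x\circ x$), a unit element ($e_{\mathbb X}$, resp. $e_{\mathbb Y}$), and $\langle x\circ y,z\rangle=\langle y,x\circ z\rangle$. Let $K_{\mathbb X}=\{x\circ x:x\in\mathbb X\}$ and $K_{\mathbb Y}=\{y\circ y:y\in\mathbb Y\}$. An idempotent $c$ ($c\circ c=c$) is primitive if $c\neq 0$ and $c$ is not a sum of two nonzero idempotents. Let $\mathbb V$ be a finite-dimensional real inner product space and let $P,Q\subseteq\mathbb V$ be closed convex cones, different from $\{0\}$ and $\mathbb V$, with $P\cap(-P)=\{0\}$ and $Q\cap(-Q)=\{0\}$. Let $G:\mathbb X\to\mathbb V$ and $H:\mathbb Y\to\mathbb V$ be linear maps with $G(K_{\mathbb X})=P$, $H(K_{\mathbb Y})=Q$, $G(c)\ne0$ for every primitive idempotent $c\in\mathbb X$ and $H(c)\neq 0$ for every primitive idempotent $c\in\mathbb Y$. For a set $K$ in a Euclidean space put $K^*=\{\zeta:\langle\zeta,u\rangle\ge0\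 \forall u\in K\}$. A pair $(u,v)\in\mathbb V\times\mathbb V$ is a *critical pair* of $(P,Q)$ if $u\in P$, $v\in Q$, $\|u\|=\|v\|=1$, $v-\langle u,v\rangle u\in P^*$ and $u-\langle u,v\rangle v\in Q^*$. It is an *antipodal pair* if it minimizes $\langle u,v\rangle$ over all $u\in P$, $v\in Q$ with $\|u\|=\|v\|=1$. For $\delta\in\mathbb R$, let ${\rm BCP}_\delta$ be the problem of minimizing $f_\delta(x,y)=\langle Gx,Hy\rangle-\delta\|Gx\|\,\|Hy\|$ over $x\in K_{\mathbb X}$, $y\in K_{\mathbb Y}$ with $\langle e_{\mathbb X},x\rangle=1$ and $\langle e_{\mathbb Y},y\rangle=1$. A *solution* is a global minimizer. A *stationary point* is a feasible $(\bar x,\bar y)$ for which there are $\gamma_1,\gamma_2\in\mathbb R$ such that $\bar x\perp\nabla_xf_\delta(\bar x,\bar y)+\gamma_1e_{\mathbb X}\in K_{\mathbb X}^*$ and $\bar y\perp\nabla_yf_\delta(\bar x,\bar y)+\gamma_2e_{\mathbb Y}\in K_{\mathbb Y}^*$. Write $\delta(x,y)=\frac{\langle Gx,Hy\rangle}{\|Gx\|\,\|Hy\|}$.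 Then: 1. If $(\bar x,\bar y)$ is a stationary point (resp. solution) of ${\rm BCP}_\delta$ with $\delta=\delta(\bar x,\bar y)$, then $(u,v)=(\|G\bar x\|^{-1}G\bar x,\ \|H\bar y\|^{-1}H\bar y)$ is a critical (resp. antipodal) pair of $(P,Q)$. 2. Conversely, if $(u,v)$ is a critical pair of $(P,Q)$, then there is a stationary point $(\bar x,\bar y)$ of ${\rm BCP}_\delta$ with $\delta=\delta(\bar x,\bar y)$ such that $(u,v)=(\|G\bar x\|^{-1}G\bar x,\ \|H\bar y\|^{-1}H\bar y)$. If $(u,v)$ is an antipodal pair of $(P,Q)$, then there is such an $(\bar x,\bar y)$ that is both a stationary point and a solution of ${\rm BCP}_\delta$ with $\delta=\delta(\bar x,\bar y)$. -/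

import Mathlib

noncomputable section

/-- A Euclidean Jordan algebra structure on a (finite-dimensional) real inner product space `X`:
a commutative bilinear product satisfying the Jordan identity, with a unit element, for which the
inner product is associative. Finite-dimensionality is a separate type class argument. -/
class EuclideanJordanAlgebra (X : Type*) [NormedAddCommGroup X] [InnerProductSpace ℝ X] where
  /-- the Jordan product -/
  jmul : X →ₗ[ℝ] X →ₗ[ℝ] X
  /-- the unit element -/
  unit : X
  jmul_comm : ∀ x y : X, jmul x y = jmul y x
  jordan_identity : ∀ x y : X, jmul x (jmul (jmul x x) y) = jmul (jmul x x) (jmul x y)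
  unit_jmul : ∀ x : X, jmul unit x = x
  inner_jmul : ∀ x y z : X, inner ℝ (jmul x y) z = inner ℝ y (jmul x z)

namespace EuclideanJordanAlgebra

variable (X : Type*) [NormedAddCommGroup X] [InnerProductSpace ℝ X] [EuclideanJordanAlgebra X]

/-- The symmetric cone of a Euclidean Jordan algebra: its set of squares. -/
def symmetricCone : Set X := {z | ∃ x : X, z = jmul x x}

variable {X}

/-- Idempotent elements. -/
def IsIdempotent (c : X) : Prop := jmul c c = c

/-- Primitive idempotents: nonzero idempotents that are not the sum of two nonzero idempotents. -/
def IsPrimitiveIdempotent (c : X) : Prop :=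
  IsIdempotent c ∧ c ≠ 0 ∧
    ¬ ∃ a b : X, IsIdempotent a ∧ IsIdempotent b ∧ a ≠ 0 ∧ b ≠ 0 ∧ c = a + b

end EuclideanJordanAlgebra

open EuclideanJordanAlgebra

/-- The closed convex cone `P` is a LISC cone (linear image of a symmetric cone), represented by
the linear map `G` defined on the Euclidean Jordan algebra `X`. -/
structure IsLISCRepresentation {X V : Type*}
    [NormedAddCommGroup X] [InnerProductSpace ℝ X] [EuclideanJordanAlgebra X]
    [NormedAddCommGroup V] [InnerProductSpace ℝ V]
    (G : X →ₗ[ℝ] V) (P : ProperCone ℝ V) : Prop where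
  image_eq : G '' symmetricCone X = (P : Set V)
  map_primitive_ne_zero : ∀ c : X, IsPrimitiveIdempotent c → G c ≠ 0
  /-- `P ∩ (-P) = {0}` -/
  pointed : ∀ u ∈ P, -u ∈ P → u = 0

/-- The data of a program `min Ψ(x, y)` subject to `x ∈ K₁`, `φ₁ x = 0`, `y ∈ K₂`, `φ₂ y = 0`. -/
structure TwoConeProgram (X Y : Type*) where
  K₁ : Set X
  K₂ : Set Y
  Ψ : X → Y → ℝ
  φ₁ : X → ℝ
  φ₂ : Y → ℝ

namespace TwoConeProgram

/-- Feasible points. -/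
def IsFeasible {X Y : Type*} (p : TwoConeProgram X Y) (x : X) (y : Y) : Prop :=
  (x ∈ p.K₁ ∧ p.φ₁ x = 0) ∧ (y ∈ p.K₂ ∧ p.φ₂ y = 0)

/-- Solutions, i.e. global minimizers. -/
def IsSolution {X Y : Type*} (p : TwoConeProgram X Y) (x : X) (y : Y) : Prop :=
  p.IsFeasible x y ∧ ∀ x' y', p.IsFeasible x' y' → p.Ψ x y ≤ p.Ψ x' y'

/-- Stationary points: there are multipliers `γ₁ γ₂` such that
`K₁ ∋ x ⟂ ∇ₓΨ(x, y) + γ₁ ∇φ₁(x) ∈ K₁*`, `K₂ ∋ y ⟂ ∇_yΨ(x, y) + γ₂ ∇φ₂(y) ∈ K₂*`,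
`φ₁ x = 0` and `φ₂ y = 0`. Meant for `Ψ`, `φ₁`, `φ₂` differentiable at the feasible points. -/
def IsStationary {X Y : Type*}
    [NormedAddCommGroup X] [InnerProductSpace ℝ X] [FiniteDimensional ℝ X]
    [NormedAddCommGroup Y] [InnerProductSpace ℝ Y] [FiniteDimensional ℝ Y]
    (p : TwoConeProgram X Y) (x : X) (y : Y) : Prop :=
  ∃ γ₁ γ₂ : ℝ,
    (x ∈ p.K₁ ∧
      inner ℝ x (gradient (fun x' => p.Ψ x' y) x + γ₁ • gradient p.φ₁ x) = 0 ∧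
      gradient (fun x' => p.Ψ x' y) x + γ₁ • gradient p.φ₁ x ∈ ProperCone.innerDual p.K₁) ∧
    (y ∈ p.K₂ ∧
      inner ℝ y (gradient (fun y' => p.Ψ x y') y + γ₂ • gradient p.φ₂ y) = 0 ∧
      gradient (fun y' => p.Ψ x y') y + γ₂ • gradient p.φ₂ y ∈ ProperCone.innerDual p.K₂) ∧
    p.φ₁ x = 0 ∧ p.φ₂ y = 0

end TwoConeProgram

section Cones

variable {V : Type*} [NormedAddCommGroup V] [InnerProductSpace ℝ V]

/-- The program `min ⟨u, v⟩` subject to `u ∈ P`, `‖u‖ = 1`, `v ∈ Q`, `‖v‖ = 1`; up to `arccos` it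
computes the maximal angle between `P` and `Q`. -/
def maximalAngleProgram (P Q : ProperCone ℝ V) : TwoConeProgram V V where
  K₁ := P
  K₂ := Q
  Ψ u v := inner ℝ u v
  φ₁ u := ‖u‖ - 1
  φ₂ v := ‖v‖ - 1

/-- Antipodal pairs of `(P, Q)`. -/
def IsAntipodalPair (P Q : ProperCone ℝ V) (u v : V) : Prop :=
  (maximalAngleProgram P Q).IsSolution u v

/-- Critical pairs of `(P, Q)`. -/
structure IsCriticalPair [FiniteDimensional ℝ V] (P Q : ProperCone ℝ V) (u v : V) : Prop where
  left_mem : u ∈ P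
  norm_left : ‖u‖ = 1
  right_mem : v ∈ Q
  norm_right : ‖v‖ = 1
  left_dual : v - (inner ℝ u v : ℝ) • u ∈ ProperCone.innerDual (P : Set V)
  right_dual : u - (inner ℝ u v : ℝ) • v ∈ ProperCone.innerDual (Q : Set V)

end Cones

section BCP

variable {X Y V : Type*}
  [NormedAddCommGroup X] [InnerProductSpace ℝ X]
  [NormedAddCommGroup Y] [InnerProductSpace ℝ Y]
  [NormedAddCommGroup V] [InnerProductSpace ℝ V]

/-- The parametric program `BCP_δ`: minimize `⟨Gx, Hy⟩ - δ ‖Gx‖ ‖Hy‖` subject to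
`x ∈ K_X`, `⟨e_X, x⟩ = 1`, `y ∈ K_Y`, `⟨e_Y, y⟩ = 1`. -/
def BCP [EuclideanJordanAlgebra X] [EuclideanJordanAlgebra Y]
    (G : X →ₗ[ℝ] V) (H : Y →ₗ[ℝ] V) (δ : ℝ) : TwoConeProgram X Y where
  K₁ := symmetricCone X
  K₂ := symmetricCone Y
  Ψ x y := inner ℝ (G x) (H y) - δ * ‖G x‖ * ‖H y‖
  φ₁ x := inner ℝ (unit : X) x - 1
  φ₂ y := inner ℝ (unit : Y) y - 1

/-- The ratio `⟨Gx, Hy⟩ / (‖Gx‖ ‖Hy‖)`. -/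
def cosineRatio (G : X →ₗ[ℝ] V) (H : Y →ₗ[ℝ] V) (x : X) (y : Y) : ℝ :=
  inner ℝ (G x) (H y) / (‖G x‖ * ‖H y‖)

end BCP

end

/-! Normalizing `(G x, H y)` maps the feasible points of the program onto the pairs of unit vectors
of `P` and `Q`, provided `G` and `H` vanish at no nonzero cone element (`map_ne_zero`). That is the
only deep use of Jordan theory: squares are nonnegative combinations of idempotents, nonzero
idempotents split into primitive ones by descent, and pointedness prevents cancellation in the
image. With `δ` the cosine ratio at `(x, y)`, the objective vanishes there and elsewhere equals
(ratio minus `δ`) times positive norms, so solutions are antipodal pairs. Its partial gradients are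
orthogonal to `x` and `y`, so both multipliers must be zero and stationarity becomes the dual cone
conditions of a critical pair. -/

/-! ### Jordan algebras: power associativity, spectral decomposition, idempotents. -/

namespace EuclideanJordanAlgebra

variable {X : Type*} [NormedAddCommGroup X] [InnerProductSpace ℝ X] [EuclideanJordanAlgebra X]

/-- The first linearization of the Jordan identity. -/
lemma jordan_identity_linearized (x z w : X) :
    (2 : ℝ) • jmul x (jmul (jmul x z) w) + jmul z (jmul (jmul x x) w) =
      (2 : ℝ) • jmul (jmul x z) (jmul x w) + jmul (jmul x x) (jmul z w) := by
  have h₁ := jordan_identity (x + z) w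
  have h₂ := jordan_identity (x - z) w
  have h₃ := jordan_identity z w
  simp only [map_add, map_sub, LinearMap.add_apply, LinearMap.sub_apply, jmul_comm z x]
    at h₁ h₂
  linear_combination (norm := module) (1 / 2 : ℝ) • h₁ - (1 / 2 : ℝ) • h₂ - h₃

lemma jmul_unit (x : X) : jmul x unit = x := by rw [jmul_comm, unit_jmul]

lemma commute_jmul_sq (x : X) : Commute (jmul (jmul x x)) (jmul x) :=
  LinearMap.ext fun y => (jordan_identity x y).symm

/-- The linearized identity read as an operator identity in `z`. For `w` a power of `x` it is a
recursion for multiplication by the power two steps higher. -/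
lemma jmul_sq_jmul (x w : X) :
    jmul (jmul (jmul x x) w) = (2 : ℝ) • (jmul (jmul x w) * jmul x) +
      jmul (jmul x x) * jmul w - (2 : ℝ) • (jmul x * jmul w * jmul x) := by
  ext z
  have h := jordan_identity_linearized x z w
  rw [jmul_comm z (jmul (jmul x x) w), jmul_comm (jmul x z) w, jmul_comm z w,
    jmul_comm (jmul x z) (jmul x w)] at h
  simp only [LinearMap.sub_apply, LinearMap.add_apply, LinearMap.smul_apply, Module.End.mul_apply]
  linear_combination (norm := module) h

/-- The recursion goes two steps back, so the induction carries two consecutive powers; it also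
involves `jmul (jmul x x)`, hence the second commutation. -/
lemma commute_jmul_pow (x : X) (n : ℕ) :
    (Commute (jmul ((jmul x ^ n) unit)) (jmul x) ∧
      Commute (jmul ((jmul x ^ n) unit)) (jmul (jmul x x))) ∧
    Commute (jmul ((jmul x ^ (n + 1)) unit)) (jmul x) ∧
      Commute (jmul ((jmul x ^ (n + 1)) unit)) (jmul (jmul x x)) := by
  have hxx := commute_jmul_sq x
  induction n with
  | zero =>
    have h : jmul (unit : X) = 1 := LinearMap.ext fun y => unit_jmul y
    simp only [pow_zero, Module.End.one_apply, h, zero_add, pow_one, jmul_unit]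
    exact ⟨⟨Commute.one_left _, Commute.one_left _⟩, Commute.refl _, hxx.symm⟩
  | succ n ih =>
    obtain ⟨⟨h₁, h₂⟩, h₃, h₄⟩ := ih
    refine ⟨⟨h₃, h₄⟩, ?_⟩
    have hpow : (jmul x ^ (n + 1 + 1)) unit = jmul (jmul x x) ((jmul x ^ n) (unit : X)) := by
      have := LinearMap.congr_fun (hxx.pow_right n).eq (unit : X)
      simp only [Module.End.mul_apply, jmul_unit] at this
      rw [this, pow_succ, pow_succ]
      simp [jmul_unit]
    have hsucc : jmul x ((jmul x ^ n) (unit : X)) = (jmul x ^ (n + 1)) unit := by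
      rw [pow_succ', Module.End.mul_apply]
    rw [hpow, jmul_sq_jmul, hsucc]
    constructor
    · exact (((h₃.mul_left (Commute.refl _)).smul_left _).add_left (hxx.mul_left h₁)).sub_left
        ((((Commute.refl _).mul_left h₁).mul_left (Commute.refl _)).smul_left _)
    · exact (((h₄.mul_left hxx.symm).smul_left _).add_left ((Commute.refl _).mul_left h₂)).sub_left
        (((hxx.symm.mul_left h₂).mul_left hxx.symm).smul_left _)

open Polynomial in
-- Power associativity: multiplication by `p(x)` commutes with `jmul x`, hence with `q(jmul x)`;
-- evaluate at the unit.
lemma jmul_aeval_aeval (x : X) (p q : ℝ[X]) :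
    jmul (aeval (jmul x) p (unit : X)) (aeval (jmul x) q unit) =
      aeval (jmul x) (p * q) (unit : X) := by
  have hp : Commute (jmul (aeval (jmul x) p (unit : X))) (jmul x) := by
    induction p using Polynomial.induction_on' with
    | add p q hp hq => simpa using hp.add_left hq
    | monomial n a =>
      simpa [aeval_monomial, Algebra.algebraMap_eq_smul_one] using
        (commute_jmul_pow x n).1.1.smul_left a
  have hpq : Commute (jmul (aeval (jmul x) p (unit : X))) (aeval (jmul x) q) := by
    induction q using Polynomial.induction_on' with
    | add p q hp hq => simpa using hp.add_right hq
    | monomial n a =>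
      simpa [aeval_monomial, Algebra.algebraMap_eq_smul_one] using
        (hp.pow_right n).smul_right a
  have := LinearMap.congr_fun hpq.eq (unit : X)
  simp only [Module.End.mul_apply, jmul_unit] at this
  rw [this, mul_comm p q, map_mul, Module.End.mul_apply]

lemma isSymmetric_jmul (x : X) : (jmul x).IsSymmetric := fun y z => inner_jmul x y z

open Polynomial in
-- `jmul x` is self-adjoint, hence diagonalizable, so only the values on its spectrum matter.
lemma aeval_jmul_eq_of_eval_eq [FiniteDimensional ℝ X] (x : X) {p q : ℝ[X]}
    (h : ∀ a, Module.End.HasEigenvalue (jmul x) a → p.eval a = q.eval a) :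
    aeval (jmul x) p = aeval (jmul x) q := by
  have htop : (⨆ a, Module.End.eigenspace (jmul x) a) = ⊤ := by
    have := (isSymmetric_jmul x).orthogonalComplement_iSup_eigenspaces_eq_bot
    rwa [Submodule.orthogonal_eq_bot_iff] at this
  rw [← sub_eq_zero, ← LinearMap.ker_eq_top, eq_top_iff, ← htop, iSup_le_iff]
  intro a v hv
  by_cases hv0 : v = 0
  · simp [hv0]
  have hev : Module.End.HasEigenvector (jmul x) a v := ⟨hv, hv0⟩
  rw [LinearMap.mem_ker, LinearMap.sub_apply, Module.End.aeval_apply_of_hasEigenvector hev,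
    Module.End.aeval_apply_of_hasEigenvector hev,
    h a (Module.End.hasEigenvalue_of_hasEigenvector hev), sub_self]

open Polynomial in
/-- Squares are nonnegative combinations of idempotents. -/
lemma exists_jmul_self_eq_sum [FiniteDimensional ℝ X] (x : X) :
    ∃ (s : Finset ℝ) (c : ℝ → X), (∀ a ∈ s, IsIdempotent (c a)) ∧
      jmul x x = ∑ a ∈ s, (a ^ 2) • c a := by
  classical
  have hfin : {a | Module.End.HasEigenvalue (jmul x) a}.Finite :=
    Module.End.finite_hasEigenvalue (jmul x)
  let s := hfin.toFinset
  have hs : ∀ a, Module.End.HasEigenvalue (jmul x) a → a ∈ s := fun a ha => by simpa [s] using ha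
  have heval : ∀ a ∈ s, ∀ b ∈ s, (Lagrange.basis s id a).eval b = if a = b then 1 else 0 := by
    intro a ha b hb
    split_ifs with hab
    · subst hab
      exact Lagrange.eval_basis_self Function.injective_id.injOn ha
    · exact Lagrange.eval_basis_of_ne (v := id) hab hb
  -- Lagrange basis polynomials are 0 or 1 on the spectrum of `jmul x`, hence idempotent there.
  refine ⟨s, fun a => aeval (jmul x) (Lagrange.basis s id a) unit, fun a ha => ?_, ?_⟩
  · rw [IsIdempotent, jmul_aeval_aeval]
    congr 1
    refine aeval_jmul_eq_of_eval_eq x fun b hb => ?_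
    rw [eval_mul, heval a ha b (hs b hb)]
    split_ifs <;> simp
  · have h : aeval (jmul x) (Polynomial.X ^ 2 : Polynomial ℝ) =
        aeval (jmul x) (∑ a ∈ s, C (a ^ 2) * Lagrange.basis s id a) := by
      refine aeval_jmul_eq_of_eval_eq x fun b hb => ?_
      rw [eval_finsetSum, Finset.sum_eq_single b]
      · simp [heval b (hs b hb) b (hs b hb)]
      · intro a ha hab
        simp [heval a ha b (hs b hb), hab]
      · exact fun hb' => absurd (hs b hb) hb'
    have := LinearMap.congr_fun h (unit : X)
    simpa [pow_two, jmul_unit, LinearMap.sum_apply, Algebra.algebraMap_eq_smul_one, mul_smul]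
      using this

lemma IsIdempotent.mem_symmetricCone {c : X} (hc : IsIdempotent c) : c ∈ symmetricCone X :=
  ⟨c, Eq.symm hc⟩

lemma smul_mem_symmetricCone {x : X} (hx : x ∈ symmetricCone X) {t : ℝ} (ht : 0 ≤ t) :
    t • x ∈ symmetricCone X := by
  obtain ⟨y, rfl⟩ := hx
  refine ⟨√t • y, ?_⟩
  rw [map_smul, map_smul, LinearMap.smul_apply, smul_smul, Real.mul_self_sqrt ht]

lemma inner_unit_pos {x : X} (hx : x ∈ symmetricCone X) (hx0 : x ≠ 0) :
    0 < inner ℝ (unit : X) x := by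
  obtain ⟨y, rfl⟩ := hx
  rw [real_inner_comm, inner_jmul, jmul_unit]
  refine real_inner_self_pos.2 ?_
  rintro rfl
  simp at hx0

/-- The norms of nonzero idempotents are bounded away from zero. -/
lemma exists_pos_le_norm_sq_of_isIdempotent [FiniteDimensional ℝ X] :
    ∃ ε > 0, ∀ c : X, IsIdempotent c → c ≠ 0 → ε ≤ ‖c‖ ^ 2 := by
  let B : X →ₗ[ℝ] X →L[ℝ] X := LinearMap.toContinuousLinearMap.toLinearMap ∘ₗ jmul
  let B' := LinearMap.toContinuousLinearMap B
  have hB : ∀ c : X, B' c c = jmul c c := fun c => rfl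
  -- From `c = c ∘ c`, `‖c‖ ≤ ‖B'‖ * ‖c‖ ^ 2`; the `+ 1` keeps the inverse positive when `B' = 0`.
  refine ⟨((‖B'‖ + 1)⁻¹) ^ 2, by positivity, fun c hc hc0 => ?_⟩
  have hpos : 0 < ‖c‖ := norm_pos_iff.2 hc0
  have h := B'.le_opNorm₂ c c
  rw [hB, show jmul c c = c from hc] at h
  gcongr
  rw [inv_le_iff_one_le_mul₀ (by positivity)]
  have : 1 ≤ ‖B'‖ * ‖c‖ := le_of_mul_le_mul_right (by linarith) hpos
  nlinarith

/-- Idempotency of the sum forces `a ∘ b = 0`, and pairing with the unit gives orthogonality. -/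
lemma norm_sq_add_of_isIdempotent {a b : X} (ha : IsIdempotent a) (hb : IsIdempotent b)
    (hab : IsIdempotent (a + b)) : ‖a + b‖ ^ 2 = ‖a‖ ^ 2 + ‖b‖ ^ 2 := by
  unfold IsIdempotent at ha hb hab
  simp only [map_add, LinearMap.add_apply, ha, hb, jmul_comm b a] at hab
  have h : jmul a b = 0 := by
    linear_combination (norm := module) (1 / 2 : ℝ) • hab
  have h' : inner ℝ a b = 0 := by
    conv_lhs => rw [← jmul_unit a]
    rw [inner_jmul, h, inner_zero_right]
  rw [norm_add_sq_real, h']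
  ring

end EuclideanJordanAlgebra

open EuclideanJordanAlgebra

/-! ### Gradients of the objective. -/

section

variable {X V : Type*} [NormedAddCommGroup X] [InnerProductSpace ℝ X] [FiniteDimensional ℝ X]
  [NormedAddCommGroup V] [InnerProductSpace ℝ V] {G : X →ₗ[ℝ] V}

lemma inner_gradient_eq_of_hasFDerivAt {f : X → ℝ} {f' : X →L[ℝ] ℝ}
    {x : X} (h : HasFDerivAt f f' x) (z : X) : inner ℝ z (gradient f x) = f' z := by
  rw [real_inner_comm, gradient, InnerProductSpace.toDual_symm_apply, h.fderiv]

lemma inner_gradient_inner_sub_norm {x : X} (hx : G x ≠ 0) (w : V)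
    (a : ℝ) {f : X → ℝ} (hf : ∀ x', f x' = inner ℝ (G x') w - a * ‖G x'‖) (z : X) :
    inner ℝ z (gradient f x) = inner ℝ (G z) (w - (a * ‖G x‖⁻¹) • G x) := by
  let G' := LinearMap.toContinuousLinearMap G
  have hG' : HasFDerivAt (fun x' => G x') G' x := G'.hasFDerivAt
  have h₁ : HasFDerivAt (fun x' => inner ℝ w (G x')) ((innerSL ℝ w).comp G') x :=
    (innerSL ℝ w).hasFDerivAt.comp x hG'
  -- The norm is differentiated as the root of its square, which is nonzero at `x`.
  have h₂ : HasFDerivAt (fun x' => √(‖G x'‖ ^ 2)) _ x :=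
    hG'.norm_sq.sqrt (by simpa using hx)
  have h₃ := h₁.fun_sub (h₂.const_mul a)
  have hfeq : f = fun x' => inner ℝ w (G x') - a * √(‖G x'‖ ^ 2) := by
    funext x'
    rw [hf, Real.sqrt_sq (norm_nonneg _), real_inner_comm]
  rw [hfeq, inner_gradient_eq_of_hasFDerivAt h₃]
  have hn : ‖G x‖ ≠ 0 := norm_ne_zero_iff.2 hx
  simp [G', inner_sub_right, inner_smul_right, Real.sqrt_sq (norm_nonneg _), real_inner_comm]
  field_simp

end

/-! ### Nonvanishing on the cone, and stationarity in one variable. -/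

section

variable {X V : Type*}
  [NormedAddCommGroup X] [InnerProductSpace ℝ X] [EuclideanJordanAlgebra X]
  [NormedAddCommGroup V] [InnerProductSpace ℝ V]
  {G : X →ₗ[ℝ] V} {P : ProperCone ℝ V}

namespace IsLISCRepresentation

lemma map_mem (hG : IsLISCRepresentation G P) {x : X} (hx : x ∈ symmetricCone X) : G x ∈ P := by
  have : G x ∈ (P : Set V) := hG.image_eq ▸ ⟨x, hx, rfl⟩
  exact this

lemma exists_map_eq (hG : IsLISCRepresentation G P) {u : V} (hu : u ∈ P) :
    ∃ x ∈ symmetricCone X, G x = u := by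
  have : u ∈ G '' symmetricCone X := hG.image_eq ▸ hu
  exact this

lemma eq_zero_of_add_eq_zero (hG : IsLISCRepresentation G P) {u v : V} (hu : u ∈ P) (hv : v ∈ P)
    (h : u + v = 0) : u = 0 :=
  hG.pointed u hu (by rwa [neg_eq_of_add_eq_zero_right h])

/-- Descent on the squared norm: splitting a non-primitive idempotent lowers it by at least `ε`, and
by pointedness `G c = 0` passes to a summand. -/
lemma map_ne_zero_of_isIdempotent [FiniteDimensional ℝ X] (hG : IsLISCRepresentation G P) {c : X}
    (hc : IsIdempotent c) (hc0 : c ≠ 0) : G c ≠ 0 := by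
  obtain ⟨ε, hε, hmin⟩ := exists_pos_le_norm_sq_of_isIdempotent (X := X)
  obtain ⟨n, hn⟩ := exists_nat_ge (‖c‖ ^ 2 / ε)
  rw [div_le_iff₀ hε] at hn
  induction n generalizing c with
  | zero =>
    have := hmin c hc hc0
    simp only [Nat.cast_zero, zero_mul] at hn
    linarith
  | succ n ih =>
    intro hGc
    refine hG.map_primitive_ne_zero c ⟨hc, hc0, ?_⟩ hGc
    rintro ⟨a, b, ha, hb, ha0, hb0, rfl⟩
    have hnorm := norm_sq_add_of_isIdempotent ha hb hc
    have := hmin b hb hb0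
    push_cast at hn
    refine ih ha ha0 (by linarith) ?_
    rw [map_add] at hGc
    exact hG.eq_zero_of_add_eq_zero (hG.map_mem ha.mem_symmetricCone)
      (hG.map_mem hb.mem_symmetricCone) hGc

lemma map_ne_zero [FiniteDimensional ℝ X] (hG : IsLISCRepresentation G P) {x : X}
    (hx : x ∈ symmetricCone X) (hx0 : x ≠ 0) : G x ≠ 0 := by
  classical
  obtain ⟨y, rfl⟩ := hx
  obtain ⟨s, c, hc, hsum⟩ := exists_jmul_self_eq_sum y
  intro hGx
  rw [hsum] at hGx hx0
  have hmem : ∀ a ∈ s, G (a ^ 2 • c a) ∈ P := fun a ha =>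
    hG.map_mem (smul_mem_symmetricCone (hc a ha).mem_symmetricCone (sq_nonneg a))
  obtain ⟨a, ha, ha0⟩ := Finset.exists_ne_zero_of_sum_ne_zero hx0
  rw [map_sum, ← Finset.add_sum_erase s _ ha] at hGx
  have h := hG.eq_zero_of_add_eq_zero (hmem a ha)
    (sum_mem fun b hb => hmem b (Finset.mem_of_mem_erase hb)) hGx
  rw [map_smul, smul_eq_zero] at h
  rw [smul_ne_zero_iff] at ha0
  exact hG.map_ne_zero_of_isIdempotent (hc a ha) ha0.2 (h.resolve_left ha0.1)

/-- Unit vectors of the cone are normalized images of feasible points. -/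
lemma exists_feasible (hG : IsLISCRepresentation G P) {u : V} (hu : u ∈ P) (hu1 : ‖u‖ = 1) :
    ∃ x ∈ symmetricCone X, inner ℝ (unit : X) x = 1 ∧ u = ‖G x‖⁻¹ • G x := by
  obtain ⟨x, hx, rfl⟩ := hG.exists_map_eq hu
  have hx0 : x ≠ 0 := by
    rintro rfl
    simp at hu1
  have hpos := inner_unit_pos hx hx0
  refine ⟨(inner ℝ (unit : X) x)⁻¹ • x, smul_mem_symmetricCone hx (by positivity), ?_, ?_⟩
  · rw [inner_smul_right, inv_mul_cancel₀ hpos.ne']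
  · rw [map_smul, norm_smul, hu1, smul_smul, mul_one, Real.norm_of_nonneg (by positivity), inv_inv,
      mul_inv_cancel₀ hpos.ne', one_smul]

lemma map_ne_zero_of_inner_unit [FiniteDimensional ℝ X] (hG : IsLISCRepresentation G P) {x : X}
    (hx : x ∈ symmetricCone X) (hx1 : inner ℝ (unit : X) x = 1) : G x ≠ 0 := by
  refine hG.map_ne_zero hx ?_
  rintro rfl
  simp at hx1

end IsLISCRepresentation

lemma inner_gradient_inner_unit_sub_one [FiniteDimensional ℝ X] (x z : X) :
    inner ℝ z (gradient (fun x' => inner ℝ (unit : X) x' - 1) x) = inner ℝ (unit : X) z := by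
  have h : HasFDerivAt (fun x' => inner ℝ (unit : X) x' - 1) (innerSL ℝ (unit : X)) x :=
    (innerSL ℝ (unit : X)).hasFDerivAt.sub_const 1
  rw [inner_gradient_eq_of_hasFDerivAt h, innerSL_apply_apply]

/-- The stationarity condition in one of the two variables, for the parameter given by the
cosine ratio, says that the corresponding condition for critical pairs holds. -/
lemma exists_multiplier_iff [FiniteDimensional ℝ X] [CompleteSpace V] (hG : IsLISCRepresentation G P)
    {x : X} (hx : x ∈ symmetricCone X) (hx1 : inner ℝ (unit : X) x = 1) (w : V)
    {a : ℝ} (ha : inner ℝ (G x) w = a * ‖G x‖)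
    {f : X → ℝ} (hf : ∀ x', f x' = inner ℝ (G x') w - a * ‖G x'‖) :
    (∃ γ : ℝ,
      inner ℝ x (gradient f x + γ • gradient (fun x' => inner ℝ (unit : X) x' - 1) x) = 0 ∧
      gradient f x + γ • gradient (fun x' => inner ℝ (unit : X) x' - 1) x ∈
        ProperCone.innerDual (symmetricCone X)) ↔
    w - (a * ‖G x‖⁻¹) • G x ∈ ProperCone.innerDual (P : Set V) := by
  have hGx := hG.map_ne_zero_of_inner_unit hx hx1
  have hn : ‖G x‖ ≠ 0 := norm_ne_zero_iff.2 hGx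
  have hinner : ∀ (γ : ℝ) (z : X), inner ℝ z (gradient f x +
      γ • gradient (fun x' => inner ℝ (unit : X) x' - 1) x) =
      inner ℝ (G z) (w - (a * ‖G x‖⁻¹) • G x) + γ * inner ℝ (unit : X) z := fun γ z => by
    rw [inner_add_right, inner_smul_right, inner_gradient_inner_sub_norm hGx w a hf,
      inner_gradient_inner_unit_sub_one]
  have hzero : inner ℝ (G x) (w - (a * ‖G x‖⁻¹) • G x) = 0 := by
    rw [inner_sub_right, inner_smul_right, real_inner_self_eq_norm_sq, ha]
    field_simp
    ring
  simp only [ProperCone.mem_innerDual, hinner, hzero, hx1, zero_add, mul_one]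
  constructor
  -- By `hzero` and `hx1`, the orthogonality condition reads `γ = 0`.
  · rintro ⟨γ, rfl, h⟩ p hp
    obtain ⟨z, hz, rfl⟩ := hG.exists_map_eq hp
    simpa using h hz
  · exact fun h => ⟨0, rfl, fun z hz => by simpa using h (hG.map_mem hz)⟩

end

/-! ### Antipodal pairs are critical. -/

section

variable {V : Type*} [NormedAddCommGroup V] [InnerProductSpace ℝ V] [CompleteSpace V]

lemma smul_mem_innerDual_iff {s : Set V} {t : ℝ} (ht : 0 < t) {w : V} :
    t • w ∈ ProperCone.innerDual s ↔ w ∈ ProperCone.innerDual s := by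
  simp only [ProperCone.mem_innerDual, inner_smul_right, mul_nonneg_iff_of_pos_left ht]

/-- First order condition for minimizing the linear function `⟪·, v⟫` on the unit vectors
of a cone. -/
lemma sub_inner_smul_mem_innerDual {P : ProperCone ℝ V} {u v : V} (hu : u ∈ P) (hu1 : ‖u‖ = 1)
    (hmin : ∀ u' ∈ P, ‖u'‖ = 1 → inner ℝ u v ≤ (inner ℝ u' v : ℝ)) :
    v - (inner ℝ u v : ℝ) • u ∈ ProperCone.innerDual (P : Set V) := by
  rw [ProperCone.mem_innerDual]
  intro p hp
  set δ : ℝ := inner ℝ u v with hδ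
  -- Homogeneity extends minimality to the whole cone, so no curve on the sphere is needed: below,
  -- `⟪u + t p, v⟫ - δ ‖u + t p‖` is zero at `t = 0` and nonnegative for `t > 0`, so its right
  -- derivative is nonnegative.
  have hcone : ∀ w ∈ P, δ * ‖w‖ ≤ inner ℝ w v := by
    intro w hw
    by_cases hw0 : w = 0
    · simp [hw0]
    have hpos : 0 < ‖w‖ := norm_pos_iff.2 hw0
    have := hmin (‖w‖⁻¹ • w) (P.smul_mem hw (by positivity))
      (by rw [norm_smul, norm_inv, norm_norm, inv_mul_cancel₀ hpos.ne'])
    rwa [real_inner_smul_left, le_inv_mul_iff₀ hpos, mul_comm] at this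
  have hline : HasDerivAt (fun t : ℝ => u + t • p) p 0 := by
    simpa using ((hasDerivAt_id (0 : ℝ)).smul_const p).const_add u
  have hnorm : HasDerivAt (fun t : ℝ => √(‖u + t • p‖ ^ 2)) (inner ℝ u p) 0 := by
    have := hline.norm_sq.sqrt (by simp [hu1])
    simpa [hu1] using this
  have hinner : HasDerivAt (fun t : ℝ => inner ℝ (u + t • p) v) (inner ℝ p v) 0 := by
    simpa using hline.inner ℝ (hasDerivAt_const (0 : ℝ) v)
  have hder := hinner.fun_sub (hnorm.const_mul δ)
  have hge : 0 ≤ inner ℝ p v - δ * inner ℝ u p := by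
    refine ge_of_tendsto hder.tendsto_slope_zero_right ?_
    filter_upwards [self_mem_nhdsWithin] with t ht
    have ht : (0 : ℝ) < t := ht
    have := hcone (u + t • p) (P.add_mem hu (P.smul_mem hp ht.le))
    simp only [zero_add, zero_smul, add_zero, hu1, one_pow, Real.sqrt_one, smul_eq_mul,
      Real.sqrt_sq (norm_nonneg _)]
    have : 0 ≤ t⁻¹ := by positivity
    rw [← hδ]
    apply mul_nonneg this
    linarith
  rwa [inner_sub_right, inner_smul_right, real_inner_comm u p]

end

section

variable {V : Type*} [NormedAddCommGroup V] [InnerProductSpace ℝ V]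

lemma norm_normalize {w : V} (hw : w ≠ 0) : ‖‖w‖⁻¹ • w‖ = 1 := by
  rw [norm_smul, norm_inv, norm_norm, inv_mul_cancel₀ (norm_ne_zero_iff.2 hw)]

lemma IsAntipodalPair.isCriticalPair [FiniteDimensional ℝ V] {P Q : ProperCone ℝ V} {u v : V}
    (h : IsAntipodalPair P Q u v) : IsCriticalPair P Q u v := by
  obtain ⟨⟨⟨hu, hu1⟩, hv, hv1⟩, hmin⟩ := h
  have hu1 : ‖u‖ = 1 := sub_eq_zero.1 hu1
  have hv1 : ‖v‖ = 1 := sub_eq_zero.1 hv1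
  refine ⟨hu, hu1, hv, hv1, sub_inner_smul_mem_innerDual hu hu1 fun u' hu' hu1' =>
    hmin u' v ⟨⟨hu', sub_eq_zero.2 hu1'⟩, hv, sub_eq_zero.2 hv1⟩, ?_⟩
  rw [real_inner_comm]
  refine sub_inner_smul_mem_innerDual hv hv1 fun v' hv' hv1' => ?_
  rw [real_inner_comm, real_inner_comm u v']
  exact hmin u v' ⟨⟨hu, sub_eq_zero.2 hu1⟩, hv', sub_eq_zero.2 hv1'⟩

end

/-! ### Transfer between the program and pairs of unit vectors. -/

section

variable {X Y V : Type*}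
  [NormedAddCommGroup X] [InnerProductSpace ℝ X] [NormedAddCommGroup Y] [InnerProductSpace ℝ Y]
  [NormedAddCommGroup V] [InnerProductSpace ℝ V] {G : X →ₗ[ℝ] V} {H : Y →ₗ[ℝ] V}

lemma inner_normalize_eq_cosineRatio (x : X) (y : Y) :
    inner ℝ (‖G x‖⁻¹ • G x) (‖H y‖⁻¹ • H y) = cosineRatio G H x y := by
  rw [real_inner_smul_left, inner_smul_right, cosineRatio, div_eq_inv_mul, mul_inv, mul_assoc]

lemma inner_eq_cosineRatio_mul {x : X} {y : Y} (hx : G x ≠ 0) (hy : H y ≠ 0) :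
    inner ℝ (G x) (H y) = cosineRatio G H x y * ‖G x‖ * ‖H y‖ := by
  have hx := norm_ne_zero_iff.2 hx
  have hy := norm_ne_zero_iff.2 hy
  rw [cosineRatio]
  field_simp

end

section

variable {X Y V : Type*}
  [NormedAddCommGroup X] [InnerProductSpace ℝ X] [FiniteDimensional ℝ X] [EuclideanJordanAlgebra X]
  [NormedAddCommGroup Y] [InnerProductSpace ℝ Y] [FiniteDimensional ℝ Y] [EuclideanJordanAlgebra Y]
  [NormedAddCommGroup V] [InnerProductSpace ℝ V]
  {P Q : ProperCone ℝ V} {G : X →ₗ[ℝ] V} {H : Y →ₗ[ℝ] V}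

lemma isStationary_iff_isCriticalPair [FiniteDimensional ℝ V]
    (hG : IsLISCRepresentation G P) (hH : IsLISCRepresentation H Q) {x : X} {y : Y}
    (hx : x ∈ symmetricCone X) (hx1 : inner ℝ (unit : X) x = 1)
    (hy : y ∈ symmetricCone Y) (hy1 : inner ℝ (unit : Y) y = 1) :
    (BCP G H (cosineRatio G H x y)).IsStationary x y ↔
      IsCriticalPair P Q (‖G x‖⁻¹ • G x) (‖H y‖⁻¹ • H y) := by
  have hGx := hG.map_ne_zero_of_inner_unit hx hx1
  have hHy := hH.map_ne_zero_of_inner_unit hy hy1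
  have hGn := norm_pos_iff.2 hGx
  have hHn := norm_pos_iff.2 hHy
  have hδ := inner_eq_cosineRatio_mul hGx hHy
  have hinner := inner_normalize_eq_cosineRatio (G := G) (H := H) x y
  set δ := cosineRatio G H x y
  have key₁ := exists_multiplier_iff hG hx hx1 (H y) (a := δ * ‖H y‖) (by rw [hδ]; ring)
    (f := fun x' => inner ℝ (G x') (H y) - δ * ‖G x'‖ * ‖H y‖) (fun x' => by ring)
  have key₂ := exists_multiplier_iff hH hy hy1 (G x) (a := δ * ‖G x‖)
    (by rw [real_inner_comm, hδ])
    (f := fun y' => inner ℝ (G x) (H y') - δ * ‖G x‖ * ‖H y'‖)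
    (fun y' => by rw [real_inner_comm])
  -- The two dual conditions differ only by a positive factor, which a cone ignores.
  have e₁ : H y - (δ * ‖H y‖ * ‖G x‖⁻¹) • G x =
      ‖H y‖ • (‖H y‖⁻¹ • H y - δ • ‖G x‖⁻¹ • G x) := by
    rw [smul_sub, smul_inv_smul₀ hHn.ne', smul_smul, smul_smul]
    congr 2
    ring
  have e₂ : G x - (δ * ‖G x‖ * ‖H y‖⁻¹) • H y =
      ‖G x‖ • (‖G x‖⁻¹ • G x - δ • ‖H y‖⁻¹ • H y) := by
    rw [smul_sub, smul_inv_smul₀ hGn.ne', smul_smul, smul_smul]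
    congr 2
    ring
  rw [e₁, smul_mem_innerDual_iff hHn] at key₁
  rw [e₂, smul_mem_innerDual_iff hGn] at key₂
  constructor
  · rintro ⟨γ₁, γ₂, ⟨-, h₁⟩, ⟨-, h₂⟩, -⟩
    refine ⟨P.smul_mem (hG.map_mem hx) (by positivity), norm_normalize hGx,
      Q.smul_mem (hH.map_mem hy) (by positivity), norm_normalize hHy, ?_, ?_⟩
    · rw [hinner]
      exact key₁.1 ⟨γ₁, h₁⟩
    · rw [hinner]
      exact key₂.1 ⟨γ₂, h₂⟩
  · intro h
    have h₁ := h.left_dual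
    have h₂ := h.right_dual
    rw [hinner] at h₁ h₂
    obtain ⟨γ₁, h₁⟩ := key₁.2 h₁
    obtain ⟨γ₂, h₂⟩ := key₂.2 h₂
    exact ⟨γ₁, γ₂, ⟨hx, h₁⟩, ⟨hy, h₂⟩, sub_eq_zero.2 hx1, sub_eq_zero.2 hy1⟩

lemma isSolution_iff_isAntipodalPair
    (hG : IsLISCRepresentation G P) (hH : IsLISCRepresentation H Q) {x : X} {y : Y}
    (hx : x ∈ symmetricCone X) (hx1 : inner ℝ (unit : X) x = 1)
    (hy : y ∈ symmetricCone Y) (hy1 : inner ℝ (unit : Y) y = 1) :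
    (BCP G H (cosineRatio G H x y)).IsSolution x y ↔
      IsAntipodalPair P Q (‖G x‖⁻¹ • G x) (‖H y‖⁻¹ • H y) := by
  have hmem : ∀ {x' : X} {y' : Y}, x' ∈ symmetricCone X → inner ℝ (unit : X) x' = 1 →
      y' ∈ symmetricCone Y → inner ℝ (unit : Y) y' = 1 →
      (maximalAngleProgram P Q).IsFeasible (‖G x'‖⁻¹ • G x') (‖H y'‖⁻¹ • H y') :=
    fun hx' hx1' hy' hy1' =>
      ⟨⟨P.smul_mem (hG.map_mem hx') (by positivity),
        sub_eq_zero.2 (norm_normalize (hG.map_ne_zero_of_inner_unit hx' hx1'))⟩,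
      Q.smul_mem (hH.map_mem hy') (by positivity),
        sub_eq_zero.2 (norm_normalize (hH.map_ne_zero_of_inner_unit hy' hy1'))⟩
  -- The left value is 0 by choice of `δ`; dividing by the positive norms leaves a comparison of
  -- ratios.
  have hval : ∀ {x' : X} {y' : Y}, x' ∈ symmetricCone X → inner ℝ (unit : X) x' = 1 →
      y' ∈ symmetricCone Y → inner ℝ (unit : Y) y' = 1 →
      ((BCP G H (cosineRatio G H x y)).Ψ x y ≤ (BCP G H (cosineRatio G H x y)).Ψ x' y' ↔
        cosineRatio G H x y ≤ cosineRatio G H x' y') := by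
    intro x' y' hx' hx1' hy' hy1'
    have hGx' := hG.map_ne_zero_of_inner_unit hx' hx1'
    have hHy' := hH.map_ne_zero_of_inner_unit hy' hy1'
    have hpos : 0 < ‖G x'‖ * ‖H y'‖ := mul_pos (norm_pos_iff.2 hGx') (norm_pos_iff.2 hHy')
    simp only [BCP]
    rw [inner_eq_cosineRatio_mul (hG.map_ne_zero_of_inner_unit hx hx1)
      (hH.map_ne_zero_of_inner_unit hy hy1), sub_self, inner_eq_cosineRatio_mul hGx' hHy',
      sub_nonneg, mul_assoc, mul_assoc, mul_le_mul_iff_left₀ hpos]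
  constructor
  · rintro ⟨-, hmin⟩
    refine ⟨hmem hx hx1 hy hy1, ?_⟩
    rintro u v ⟨⟨hu, hu1⟩, hv, hv1⟩
    obtain ⟨x', hx', hx1', rfl⟩ := hG.exists_feasible hu (sub_eq_zero.1 hu1)
    obtain ⟨y', hy', hy1', rfl⟩ := hH.exists_feasible hv (sub_eq_zero.1 hv1)
    simp only [maximalAngleProgram, inner_normalize_eq_cosineRatio]
    exact (hval hx' hx1' hy' hy1').1
      (hmin x' y' ⟨⟨hx', sub_eq_zero.2 hx1'⟩, hy', sub_eq_zero.2 hy1'⟩)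
  · rintro ⟨-, hmin⟩
    refine ⟨⟨⟨hx, sub_eq_zero.2 hx1⟩, hy, sub_eq_zero.2 hy1⟩, ?_⟩
    rintro x' y' ⟨⟨hx', hx1'⟩, hy', hy1'⟩
    have hx1' := sub_eq_zero.1 hx1'
    have hy1' := sub_eq_zero.1 hy1'
    have := hmin _ _ (hmem hx' hx1' hy' hy1')
    simp only [maximalAngleProgram, inner_normalize_eq_cosineRatio] at this
    exact (hval hx' hx1' hy' hy1').2 this

end

theorem corollary4p2 {X Y V : Type*}
    [NormedAddCommGroup X] [InnerProductSpace ℝ X] [FiniteDimensional ℝ X]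
    [EuclideanJordanAlgebra X]
    [NormedAddCommGroup Y] [InnerProductSpace ℝ Y] [FiniteDimensional ℝ Y]
    [EuclideanJordanAlgebra Y]
    [NormedAddCommGroup V] [InnerProductSpace ℝ V] [FiniteDimensional ℝ V]
    (P Q : ProperCone ℝ V)
    (hP_bot : (P : Set V) ≠ {0}) (hP_top : (P : Set V) ≠ Set.univ)
    (hQ_bot : (Q : Set V) ≠ {0}) (hQ_top : (Q : Set V) ≠ Set.univ)
    (G : X →ₗ[ℝ] V) (H : Y →ₗ[ℝ] V)
    (hG : IsLISCRepresentation G P) (hH : IsLISCRepresentation H Q) :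
    (∀ (x : X) (y : Y), (BCP G H (cosineRatio G H x y)).IsStationary x y →
      IsCriticalPair P Q (‖G x‖⁻¹ • G x) (‖H y‖⁻¹ • H y)) ∧
    (∀ (x : X) (y : Y), (BCP G H (cosineRatio G H x y)).IsSolution x y →
      IsAntipodalPair P Q (‖G x‖⁻¹ • G x) (‖H y‖⁻¹ • H y)) ∧
    (∀ u v : V, IsCriticalPair P Q u v →
      ∃ (x : X) (y : Y), (BCP G H (cosineRatio G H x y)).IsStationary x y ∧
        u = ‖G x‖⁻¹ • G x ∧ v = ‖H y‖⁻¹ • H y) ∧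
    (∀ u v : V, IsAntipodalPair P Q u v →
      ∃ (x : X) (y : Y), (BCP G H (cosineRatio G H x y)).IsStationary x y ∧
        (BCP G H (cosineRatio G H x y)).IsSolution x y ∧
        u = ‖G x‖⁻¹ • G x ∧ v = ‖H y‖⁻¹ • H y) := by

  refine ⟨fun x y h => ?_, fun x y h => ?_, fun u v h => ?_, fun u v h => ?_⟩
  · have ⟨_, _, ⟨hx, _⟩, ⟨hy, _⟩, hx1, hy1⟩ := h
    exact (isStationary_iff_isCriticalPair hG hH hx (sub_eq_zero.1 hx1) hy
      (sub_eq_zero.1 hy1)).1 h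
  · have ⟨⟨⟨hx, hx1⟩, hy, hy1⟩, _⟩ := h
    exact (isSolution_iff_isAntipodalPair hG hH hx (sub_eq_zero.1 hx1) hy
      (sub_eq_zero.1 hy1)).1 h
  · obtain ⟨x, hx, hx1, rfl⟩ := hG.exists_feasible h.left_mem h.norm_left
    obtain ⟨y, hy, hy1, rfl⟩ := hH.exists_feasible h.right_mem h.norm_right
    exact ⟨x, y, (isStationary_iff_isCriticalPair hG hH hx hx1 hy hy1).2 h, rfl, rfl⟩
  · have hc := h.isCriticalPair
    obtain ⟨x, hx, hx1, rfl⟩ := hG.exists_feasible hc.left_mem hc.norm_left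
    obtain ⟨y, hy, hy1, rfl⟩ := hH.exists_feasible hc.right_mem hc.norm_right
    exact ⟨x, y, (isStationary_iff_isCriticalPair hG hH hx hx1 hy hy1).2 hc,
      (isSolution_iff_isAntipodalPair hG hH hx hx1 hy hy1).2 h, rfl, rfl⟩
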